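/- Let $\mathcal C$ be a covering of a finite set $U$, i.e. a set of subsets of $U$ with union $U$. Let $M(\mathcal C)$ be its transversal matroid on $U$, whose independent sets are the partial transversals of $\mathcal C$ (the sets $X\subseteq U$ admitting an injection $f:X\to\mathcal C$ with $x\in f(x)$ for all $x\in X$), and let $L(\mathcal C)$ be the lattice of closed sets (flats) of $M(\mathcal C)$, ordered by inclusion. For $x\in U$ let $\mathcal C(x)=\{K\in\mathcal C: x\in K\}$. Define $x\sim y$ if $x=y$, or $\mathcal C(x)=\mathcal C(y)$ and $|\mathcal C(x)|=1$, and let $m=|U/{\sim}|$; thus $m=|U|$ if $\mathcal C$ is reduced, i.e. if all classes of $\sim$ are singletons. For $x\in U$ with $|\mathcal C(x)|=2$ let $E(x)=\{y\in U:\mathcal C(y)\subseteq\mathcal C(x)\}$, and let $k$ be the number of distinct sets among these $E(x)$. Let $G$ be a finite group, let $n\ge 0$, and let $Q_n(G)$ be the Dowling lattice. Its elements are partial $G$-partitions of $\{1,\dots,n\}$, that is, a zero block $Z$, a partition of the complement of $Z$ into nonempty blocks $B_i$, and labelings $a_i:B_i\to G$, each $a_i$ taken up to left multiplication by a constant. One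 has $(Z;(B_i,a_i))\le(Z';(C_j,b_j))$ iff $Z\subseteq Z'$, every $C_j$ is a union of some of the $B_i$, and whenever $B_i\subseteq C_j$ there is $g\in G$ with $b_j(x)=g\,a_i(x)$ for all $x\in B_i$. Theorem. If $L(\mathcal C)\cong Q_n(G)$, then $n\in\{0,1,2\}$. If moreover $n=2$, then $m=|G|+2$ (in particular $|U|=|G|+2$ if $\mathcal C$ is reduced) and $k=1$, and $|U|=k\cdot|E(x)|$ for every $x$ with $|\mathcal C(x)|=2$. -/

import Mathlib

/-! ### Coverings and the transversal matroid of a covering -/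

namespace CoveringLattice

universe u

variable {U : Type u}

/-- `C` is a covering of the set `U`: a set of subsets of `U` whose union is `U`. -/
def IsCovering (C : Set (Set U)) : Prop := ⋃₀ C = Set.univ

/-- `C(H)`, the set of blocks of `C` that meet `H`. -/
def blocksMeeting (C : Set (Set U)) (H : Set U) : Set (Set U) :=
  {K | K ∈ C ∧ (K ∩ H).Nonempty}

/-- `X` is a partial transversal of `C`: its elements can be assigned pairwise distinct blocks
of `C`, each containing the element it is assigned to. -/
def IsPartialTransversal (C : Set (Set U)) (X : Set U) : Prop :=
  ∃ f : U → Set U, Set.InjOn f X ∧ ∀ x ∈ X, f x ∈ C ∧ x ∈ f x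

theorem isPartialTransversal_iff [Finite U] (C : Set (Set U)) (X : Set U) :
    IsPartialTransversal C X ↔ ∀ H ⊆ X, H.ncard ≤ (blocksMeeting C H).ncard := by
  classical
  have := Fintype.ofFinite U
  constructor
  · rintro ⟨f, hf, hfC⟩ H hH
    refine Set.ncard_le_ncard_of_injOn f ?_ (hf.mono hH) (Set.toFinite _)
    intro x hx
    exact ⟨(hfC x (hH hx)).1, x, (hfC x (hH hx)).2, hx⟩
  · intro h
    have key := (Fintype.all_card_le_filter_rel_iff_exists_injective
      (fun (a : X) (K : Set U) => K ∈ C ∧ (a : U) ∈ K)).1 (by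
        intro A
        have h1 := h (((↑) : X → U) '' (A : Set X)) (by rintro _ ⟨a, _, rfl⟩; exact a.2)
        rw [Set.ncard_image_of_injective _ Subtype.val_injective, Set.ncard_coe_finset] at h1
        refine h1.trans ?_
        rw [← Set.ncard_coe_finset]
        refine Set.ncard_le_ncard ?_ (Set.toFinite _)
        rintro K ⟨hK, x, hxK, a, ha, rfl⟩
        simp only [Finset.coe_filter, Finset.mem_univ, true_and, Set.mem_ofPred_eq]
        exact ⟨a, ha, hK, hxK⟩)
    obtain ⟨f, hf, hfC⟩ := key
    refine ⟨fun x => if hx : x ∈ X then f ⟨x, hx⟩ else ∅, ?_, ?_⟩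
    · intro x hx y hy hxy
      simp only [hx, hy, dif_pos] at hxy
      exact congrArg Subtype.val (hf hxy)
    · intro x hx
      simp only [hx, dif_pos]
      exact hfC ⟨x, hx⟩

theorem blocksMeeting_mono (C : Set (Set U)) {H H' : Set U} (h : H ⊆ H') :
    blocksMeeting C H ⊆ blocksMeeting C H' :=
  fun _ hK => ⟨hK.1, hK.2.mono (Set.inter_subset_inter_right _ h)⟩

theorem blocksMeeting_union (C : Set (Set U)) (H H' : Set U) :
    blocksMeeting C (H ∪ H') = blocksMeeting C H ∪ blocksMeeting C H' := by
  ext K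
  simp only [blocksMeeting, Set.mem_ofPred_eq, Set.mem_union, Set.inter_union_distrib_left,
    Set.union_nonempty]
  tauto

theorem isPartialTransversal_empty (C : Set (Set U)) : IsPartialTransversal C ∅ :=
  ⟨fun _ => ∅, by simp, by simp⟩

theorem IsPartialTransversal.subset {C : Set (Set U)} {I J : Set U}
    (hJ : IsPartialTransversal C J) (h : I ⊆ J) : IsPartialTransversal C I := by
  obtain ⟨f, hf, hfC⟩ := hJ
  exact ⟨f, hf.mono h, fun x hx => hfC x (h hx)⟩

/-- The augmentation property of partial transversals. -/
theorem IsPartialTransversal.augment [Finite U] {C : Set (Set U)} {I J : Set U}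
    (hI : IsPartialTransversal C I) (hJ : IsPartialTransversal C J) (hIJ : I.ncard < J.ncard) :
    ∃ e ∈ J, e ∉ I ∧ IsPartialTransversal C (insert e I) := by
  by_contra hcon
  push Not at hcon
  rw [isPartialTransversal_iff] at hI hJ
  -- every element of `J \ I` has all its blocks among those meeting a tight subset of `I`
  have h1 : ∀ e ∈ J \ I, ∃ T ⊆ I, (blocksMeeting C T).ncard ≤ T.ncard ∧
      blocksMeeting C {e} ⊆ blocksMeeting C T := by
    rintro e ⟨heJ, heI⟩
    have h2 := hcon e heJ heI
    rw [isPartialTransversal_iff] at h2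
    push Not at h2
    obtain ⟨H, hH, hlt⟩ := h2
    have heH : e ∈ H := by
      by_contra hne
      have : H ⊆ I := fun x hx => (hH hx).resolve_left (fun h => hne (h ▸ hx))
      exact absurd (hI H this) (not_le.2 hlt)
    have hHI : H \ {e} ⊆ I := fun x hx => (hH hx.1).resolve_left hx.2
    have hc : (H \ {e}).ncard + 1 = H.ncard := Set.ncard_sdiff_singleton_add_one heH
    have h4 : blocksMeeting C (H \ {e}) ⊆ blocksMeeting C H :=
      blocksMeeting_mono C Set.sdiff_subset
    have h5 := hI _ hHI
    have h6 := Set.ncard_le_ncard h4 (Set.toFinite _)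
    refine ⟨H \ {e}, hHI, by omega, ?_⟩
    rw [Set.eq_of_subset_of_ncard_le h4 (by omega) (Set.toFinite _)]
    exact blocksMeeting_mono C (Set.singleton_subset_iff.2 heH)
  -- tight subsets of `I` are closed under union
  have h2 : ∀ A ⊆ I, ∀ B ⊆ I, (blocksMeeting C A).ncard ≤ A.ncard →
      (blocksMeeting C B).ncard ≤ B.ncard →
      (blocksMeeting C (A ∪ B)).ncard ≤ (A ∪ B).ncard := by
    intro A hA B hB hcA hcB
    have e1 := Set.ncard_union_add_ncard_inter A B (Set.toFinite _) (Set.toFinite _)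
    have e2 := Set.ncard_union_add_ncard_inter (blocksMeeting C A) (blocksMeeting C B)
      (Set.toFinite _) (Set.toFinite _)
    have e3 := hI (A ∩ B) (Set.inter_subset_left.trans hA)
    have e4 : (blocksMeeting C (A ∩ B)).ncard ≤
        (blocksMeeting C A ∩ blocksMeeting C B).ncard :=
      Set.ncard_le_ncard (Set.subset_inter (blocksMeeting_mono C Set.inter_subset_left)
        (blocksMeeting_mono C Set.inter_subset_right)) (Set.toFinite _)
    rw [blocksMeeting_union]
    omega
  have h3 : ∃ T ⊆ I, (blocksMeeting C T).ncard ≤ T.ncard ∧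
      blocksMeeting C (J \ I) ⊆ blocksMeeting C T := by
    refine Set.Finite.induction_on_subset
      (motive := fun S _ => ∃ T ⊆ I, (blocksMeeting C T).ncard ≤ T.ncard ∧
        blocksMeeting C S ⊆ blocksMeeting C T) (J \ I) (Set.toFinite _) ?_ ?_
    · exact ⟨∅, Set.empty_subset _, by simp [blocksMeeting], subset_rfl⟩
    · rintro a S ha _ _ ⟨T, hT, hcT, hST⟩
      obtain ⟨T', hT', hcT', haT'⟩ := h1 a ha
      refine ⟨T' ∪ T, Set.union_subset hT' hT, h2 _ hT' _ hT hcT' hcT, ?_⟩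
      rw [← Set.singleton_union, blocksMeeting_union, blocksMeeting_union]
      exact Set.union_subset_union haT' hST
  obtain ⟨T, hT, hcT, hJT⟩ := h3
  have e1 := hJ ((J \ I) ∪ (J ∩ T)) (Set.union_subset Set.sdiff_subset Set.inter_subset_left)
  have e2 : blocksMeeting C ((J \ I) ∪ (J ∩ T)) ⊆ blocksMeeting C T := by
    rw [blocksMeeting_union]
    exact Set.union_subset hJT (blocksMeeting_mono C Set.inter_subset_right)
  have e3 := Set.ncard_le_ncard e2 (Set.toFinite _)
  have e4 : ((J \ I) ∪ (J ∩ T)).ncard = (J \ I).ncard + (J ∩ T).ncard :=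
    Set.ncard_union_eq (Set.disjoint_left.2 fun x hx hx' => hx.2 (hT hx'.2))
      (Set.toFinite _) (Set.toFinite _)
  have e5 := Set.ncard_sdiff_add_ncard_of_subset hT (Set.toFinite _)
  have e6 := Set.ncard_inter_add_ncard_sdiff_eq_ncard J I (Set.toFinite _)
  have e7 : (J ∩ I).ncard ≤ (J ∩ T).ncard + (I \ T).ncard := by
    refine (Set.ncard_le_ncard ?_ (Set.toFinite _)).trans (Set.ncard_union_le _ _)
    rintro x ⟨hxJ, hxI⟩
    by_cases hx : x ∈ T
    · exact Or.inl ⟨hxJ, hx⟩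
    · exact Or.inr ⟨hxI, hx⟩
  omega

/-- The transversal matroid `M(C)`: the matroid on `U` whose independent sets are the partial
transversals of `C`. -/
def transversalMatroid [Finite U] (C : Set (Set U)) : Matroid U :=
  (IndepMatroid.ofFinite (E := Set.univ) Set.finite_univ (IsPartialTransversal C)
    (isPartialTransversal_empty C) (fun _ _ hJ h => hJ.subset h)
    (fun _ _ hI hJ h => hI.augment hJ h) (fun _ _ => Set.subset_univ _)).matroid

@[simp] theorem transversalMatroid_ground [Finite U] (C : Set (Set U)) :
    (transversalMatroid C).E = Set.univ := rfl

@[simp] theorem transversalMatroid_indep [Finite U] (C : Set (Set U)) (X : Set U) :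
    (transversalMatroid C).Indep X ↔ IsPartialTransversal C X := Iff.rfl

/-- `L(C)`, the closed sets (flats) of `M(C)`, ordered by inclusion. -/
abbrev ClosedSets [Finite U] (C : Set (Set U)) : Type u :=
  {X : Set U // (transversalMatroid C).IsFlat X}

/-! ### The invariants `m` and `k` of a covering -/

/-- The relation `∼` on `U`: `x ∼ y` if `x = y`, or if `x` and `y` lie in the same blocks and
that is exactly one block. -/
def simSetoid (C : Set (Set U)) : Setoid U where
  r x y := x = y ∨
    (blocksMeeting C {x} = blocksMeeting C {y} ∧ (blocksMeeting C {x}).ncard = 1)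
  iseqv :=
    { refl := fun _ => Or.inl rfl
      symm := by
        rintro x y (h | ⟨h, h'⟩)
        · exact Or.inl h.symm
        · exact Or.inr ⟨h.symm, h ▸ h'⟩
      trans := by
        rintro x y z (rfl | ⟨h, h'⟩) (rfl | ⟨g, g'⟩)
        · exact Or.inl rfl
        · exact Or.inr ⟨g, g'⟩
        · exact Or.inr ⟨h, h'⟩
        · exact Or.inr ⟨h.trans g, h'⟩ }

/-- `C` is reduced if all classes of `∼` are singletons. -/
def IsReduced (C : Set (Set U)) : Prop := ∀ x y : U, simSetoid C x y → x = y

/-- `E(x)`: the set of all `y` such that every block containing `y` contains `x`. -/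
def lineOf (C : Set (Set U)) (x : U) : Set U :=
  {y | blocksMeeting C {y} ⊆ blocksMeeting C {x}}

/-- The family of the sets `E(x)`, over all `x` that lie in exactly two blocks. -/
def lines (C : Set (Set U)) : Set (Set U) :=
  {E | ∃ x : U, (blocksMeeting C {x}).ncard = 2 ∧ E = lineOf C x}

end CoveringLattice

/-! ### Dowling lattices -/

namespace Dowling

universe v

/-- A partial `G`-partition of `{0, …, n - 1}`: a zero block, a partition of its complement into
nonempty blocks, and a `G`-labelling of every block.  The labellings of the (disjoint) blocks are
stored together in one function, whose values on the zero block play no role. -/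
structure PartialGPartition (n : ℕ) (G : Type v) where
  zero : Finset (Fin n)
  parts : Finpartition zeroᶜ
  label : Fin n → G

namespace PartialGPartition

variable {n : ℕ} {G : Type v} [Group G]

/-- Two labellings agree on `B` up to left multiplication by a constant:
`b i = g * a i` for all `i ∈ B`. -/
def LabelEquiv (B : Finset (Fin n)) (a b : Fin n → G) : Prop :=
  ∃ g : G, ∀ i ∈ B, b i = g * a i

theorem LabelEquiv.refl (B : Finset (Fin n)) (a : Fin n → G) : LabelEquiv B a a :=
  ⟨1, by simp⟩

theorem LabelEquiv.symm {B : Finset (Fin n)} {a b : Fin n → G} (h : LabelEquiv B a b) :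
    LabelEquiv B b a := by
  obtain ⟨g, hg⟩ := h
  exact ⟨g⁻¹, fun i hi => by rw [hg i hi, inv_mul_cancel_left]⟩

theorem LabelEquiv.trans {B : Finset (Fin n)} {a b c : Fin n → G} (h : LabelEquiv B a b)
    (h' : LabelEquiv B b c) : LabelEquiv B a c := by
  obtain ⟨g, hg⟩ := h
  obtain ⟨g', hg'⟩ := h'
  exact ⟨g' * g, fun i hi => by rw [hg' i hi, hg i hi, mul_assoc]⟩

theorem LabelEquiv.mono {A B : Finset (Fin n)} {a b : Fin n → G} (h : LabelEquiv B a b)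
    (hAB : A ⊆ B) : LabelEquiv A a b := by
  obtain ⟨g, hg⟩ := h
  exact ⟨g, fun i hi => hg i (hAB hi)⟩

/-- Identification of partial `G`-partitions: same zero block, same nonzero blocks, and equivalent
labellings on each nonzero block. -/
instance setoid (n : ℕ) (G : Type v) [Group G] : Setoid (PartialGPartition n G) where
  r x y := x.zero = y.zero ∧ x.parts.parts = y.parts.parts ∧
    ∀ B ∈ x.parts.parts, LabelEquiv B x.label y.label
  iseqv :=
    { refl := fun _ => ⟨rfl, rfl, fun _ _ => LabelEquiv.refl _ _⟩
      symm := fun h => ⟨h.1.symm, h.2.1.symm, fun B hB => (h.2.2 B (h.2.1 ▸ hB)).symm⟩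
      trans := fun h h' => ⟨h.1.trans h'.1, h.2.1.trans h'.2.1,
        fun B hB => (h.2.2 B hB).trans (h'.2.2 B (h.2.1 ▸ hB))⟩ }

/-- `x ≤ y`: the zero block of `x` lies in that of `y`, every nonzero block `B'` of `y` is a union
of nonzero blocks of `x`, and on each nonzero block `B ⊆ B'` of `x` the labelling of `y` agrees
with that of `x` up to left multiplication by a constant. -/
def Le (x y : PartialGPartition n G) : Prop :=
  x.zero ⊆ y.zero ∧ ∀ B' ∈ y.parts.parts,
    (∃ P ⊆ x.parts.parts, P.biUnion id = B') ∧
    ∀ B ∈ x.parts.parts, B ⊆ B' → LabelEquiv B x.label y.label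

theorem Le.of_equiv {x y : PartialGPartition n G} (h : x ≈ y) : Le x y := by
  obtain ⟨h1, h2, h3⟩ := h
  refine ⟨h1.subset, fun B' hB' => ⟨⟨{B'}, ?_, by simp⟩, fun B hB _ => h3 B hB⟩⟩
  rw [h2]
  simpa using hB'

theorem Le.trans {x y z : PartialGPartition n G} (h : Le x y) (h' : Le y z) : Le x z := by
  classical
  refine ⟨h.1.trans h'.1, fun D hD => ?_⟩
  obtain ⟨⟨Q, hQ, rfl⟩, hlab⟩ := h'.2 D hD
  have hx : ∀ B ∈ x.parts.parts, ∀ B' ∈ y.parts.parts, (B ∩ B').Nonempty → B ⊆ B' := by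
    rintro B hB B' hB' ⟨i, hi⟩
    obtain ⟨⟨P, hP, rfl⟩, _⟩ := h.2 B' hB'
    rw [Finset.mem_inter, Finset.mem_biUnion] at hi
    obtain ⟨hiB, A, hA, hiA⟩ := hi
    rw [x.parts.eq_of_mem_parts hB (hP hA) hiB hiA]
    exact Finset.subset_biUnion_of_mem id hA
  refine ⟨?_, ?_⟩
  · refine ⟨x.parts.parts.filter fun B => ∃ B' ∈ Q, B ⊆ B', Finset.filter_subset _ _, ?_⟩
    ext i
    simp only [Finset.mem_biUnion, Finset.mem_filter, id]
    constructor
    · rintro ⟨B, ⟨_, B', hB', hBB'⟩, hi⟩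
      exact ⟨B', hB', hBB' hi⟩
    · rintro ⟨B', hB', hi⟩
      obtain ⟨⟨P, hP, rfl⟩, _⟩ := h.2 B' (hQ hB')
      obtain ⟨A, hA, hiA⟩ := Finset.mem_biUnion.1 hi
      exact ⟨A, ⟨hP hA, _, hB', Finset.subset_biUnion_of_mem id hA⟩, hiA⟩
  · intro B hB hBD
    obtain ⟨i, hi⟩ := x.parts.nonempty_of_mem_parts hB
    obtain ⟨B', hB', hiB'⟩ := Finset.mem_biUnion.1 (hBD hi)
    have hsub : B ⊆ B' := hx B hB B' (hQ hB') ⟨i, Finset.mem_inter.2 ⟨hi, hiB'⟩⟩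
    exact ((h.2 B' (hQ hB')).2 B hB hsub).trans
      ((hlab B' (hQ hB') (Finset.subset_biUnion_of_mem id hB')).mono hsub)

theorem Le.antisymm {x y : PartialGPartition n G} (h : Le x y) (h' : Le y x) : x ≈ y := by
  have key : ∀ {x y : PartialGPartition n G}, Le x y → Le y x →
      y.parts.parts ⊆ x.parts.parts := by
    intro x y h h' B' hB'
    obtain ⟨⟨P, hP, hPB⟩, _⟩ := h.2 B' hB'
    obtain ⟨i, hi⟩ := y.parts.nonempty_of_mem_parts hB'
    rw [← hPB] at hi
    obtain ⟨A, hA, hiA⟩ := Finset.mem_biUnion.1 hi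
    have hAB : A ⊆ B' := hPB ▸ Finset.subset_biUnion_of_mem id hA
    obtain ⟨⟨Q, hQ, hQA⟩, _⟩ := h'.2 A (hP hA)
    have hiQ : i ∈ Q.biUnion id := hQA.symm ▸ hiA
    obtain ⟨D, hD, hiD⟩ := Finset.mem_biUnion.1 hiQ
    have hDB : D = B' := y.parts.eq_of_mem_parts (hQ hD) hB' hiD (hAB hiA)
    have hBA : B' ⊆ A := hQA ▸ hDB ▸ Finset.subset_biUnion_of_mem id hD
    exact (hBA.antisymm hAB) ▸ hP hA
  have hp : x.parts.parts = y.parts.parts := (key h' h).antisymm (key h h')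
  exact ⟨h.1.antisymm h'.1, hp, fun B hB => (h.2 B (hp ▸ hB)).2 B hB subset_rfl⟩

end PartialGPartition

/-- The Dowling lattice `Q_n(G)`: partial `G`-partitions of an `n`-element set up to
identification. -/
def DowlingLattice (n : ℕ) (G : Type v) [Group G] : Type v :=
  Quotient (PartialGPartition.setoid n G)

instance (n : ℕ) (G : Type v) [Group G] : PartialOrder (DowlingLattice n G) where
  le := Quotient.lift₂ PartialGPartition.Le (by
    intro a b a' b' ha hb
    exact propext
      ⟨fun h => ((PartialGPartition.Le.of_equiv (Setoid.symm ha)).trans h).trans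
          (PartialGPartition.Le.of_equiv hb),
        fun h => ((PartialGPartition.Le.of_equiv ha).trans h).trans
          (PartialGPartition.Le.of_equiv (Setoid.symm hb))⟩)
  le_refl := by
    rintro ⟨x⟩
    exact PartialGPartition.Le.of_equiv (Setoid.refl x)
  le_trans := by
    rintro ⟨x⟩ ⟨y⟩ ⟨z⟩ h h'
    exact PartialGPartition.Le.trans h h'
  le_antisymm := by
    rintro ⟨x⟩ ⟨y⟩ h h'
    exact Quotient.sound (PartialGPartition.Le.antisymm h h')

end Dowling

/-! An isomorphism preserves points and collinearity, where a point is collinear with two others if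
it lies below all their common upper bounds. For a covering, the points are the classes of `∼`. By
Hall's theorem, three distinct points are collinear exactly if their elements meet at most two
blocks (`collinear_iff`): smaller sets of inequivalent elements never violate Hall's condition.

So a line with at least three points is carried by a pair of blocks. An element on two lines carried
by different pairs lies in only one block (`ncard_blocksMeeting_eq_one`), but a pair of blocks has
room for only two inequivalent elements of this kind (`not_forall_ncard_eq_one`). Hence among any
three points of a line, one lies on no other line with three points.

For `n ≥ 3` the Dowling lattice violates this. The zero points of three indices and the three pair
points with label quotient `1` form a complete quadrilateral: six points on four three-point lines,
each point on two of them. For `n = 2` any two points span the top, so a single line carries all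
`|G| + 2` points. Then there are just two nonempty blocks, some element lies in both, and its `E(x)`
is all of `U`. -/

/-- An element of a partial order that lies directly above the bottom: it is not below everything,
while every strictly smaller element is. -/
def IsPoint {P : Type*} [PartialOrder P] (p : P) : Prop :=
  (∃ r, ¬ p ≤ r) ∧ ∀ r ≤ p, r = p ∨ ∀ s, r ≤ s

theorem IsPoint.eq_of_le {P : Type*} [PartialOrder P] {p q : P} (hp : IsPoint p)
    (hq : IsPoint q) (h : p ≤ q) : p = q :=
  (hq.2 p h).resolve_right fun h' => hp.1.elim fun r hr => hr (h' r)

namespace CoveringLattice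

/-! ### Hall's condition for at most three elements -/

section Blocks

variable {U : Type*} {C : Set (Set U)}

theorem IsCovering.blocksMeeting_nonempty (hC : IsCovering C) (x : U) :
    (blocksMeeting C {x}).Nonempty := by
  obtain ⟨K, hK, hx⟩ : x ∈ ⋃₀ C := hC.symm ▸ Set.mem_univ x
  exact ⟨K, hK, x, hx, rfl⟩

theorem ne_of_not_simSetoid {x y : U} (h : ¬ simSetoid C x y) : x ≠ y :=
  fun h' => h (Or.inl h')

variable [Finite U]

/-- If `H` met only one block, each of its elements would lie in exactly that block, and all of them
would be equivalent. -/
theorem IsCovering.two_le_ncard_blocksMeeting (hC : IsCovering C) {x y : U}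
    (hxy : ¬ simSetoid C x y) {H : Set U} (hx : x ∈ H) (hy : y ∈ H) :
    2 ≤ (blocksMeeting C H).ncard := by
  by_contra! h
  have key : ∀ z ∈ H, blocksMeeting C {z} = blocksMeeting C H ∧
      (blocksMeeting C {z}).ncard = 1 := by
    intro z hz
    have h1 := blocksMeeting_mono C (Set.singleton_subset_iff.2 hz)
    have h2 := (Set.ncard_pos (Set.toFinite _)).2 (hC.blocksMeeting_nonempty z)
    have h3 := Set.eq_of_subset_of_ncard_le h1 (by omega) (Set.toFinite _)
    exact ⟨h3, by rw [h3] at h2 ⊢; omega⟩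
  exact hxy (Or.inr ⟨(key x hx).1.trans (key y hy).1.symm, (key x hx).2⟩)

/-- Proper subsets of `T` have at most two elements and satisfy Hall's condition automatically:
singletons because `C` covers, pairs because their elements are inequivalent. Only `T` itself has to
be checked. -/
theorem IsCovering.isPartialTransversal (hC : IsCovering C) {T : Set U}
    (hT : T.Pairwise fun x y => ¬ simSetoid C x y) (h3 : T.ncard ≤ 3)
    (hcard : T.ncard ≤ (blocksMeeting C T).ncard) : IsPartialTransversal C T := by
  rw [isPartialTransversal_iff]
  intro H hH
  obtain rfl | hne := eq_or_ne H T
  · exact hcard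
  have hlt : H.ncard < T.ncard := Set.ncard_lt_ncard (hH.ssubset_of_ne hne) (Set.toFinite _)
  obtain h | h | h : H.ncard = 0 ∨ H.ncard = 1 ∨ H.ncard = 2 := by omega
  · omega
  · obtain ⟨x, rfl⟩ := Set.ncard_eq_one.1 h
    rw [h]
    exact (Set.ncard_pos (Set.toFinite _)).2 (hC.blocksMeeting_nonempty x)
  · obtain ⟨x, y, hxy, rfl⟩ := Set.ncard_eq_two.1 h
    rw [h]
    exact hC.two_le_ncard_blocksMeeting (hT (hH (by simp)) (hH (by simp)) hxy)
      (by simp) (by simp)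

theorem ncard_triple {α : Type*} {x y z : α} (hxy : x ≠ y) (hxz : x ≠ z) (hyz : y ≠ z) :
    ({x, y, z} : Set α).ncard = 3 := by
  classical
  exact Set.ncard_eq_three.2 ⟨x, y, z, hxy, hxz, hyz, rfl⟩

theorem IsCovering.pair_indep (hC : IsCovering C) {x y : U} (hxy : ¬ simSetoid C x y) :
    (transversalMatroid C).Indep {x, y} := by
  rw [transversalMatroid_indep]
  have h2 : ({x, y} : Set U).ncard = 2 := Set.ncard_pair (ne_of_not_simSetoid hxy)
  refine hC.isPartialTransversal ?_ (by omega)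
    (h2 ▸ hC.two_le_ncard_blocksMeeting hxy (by simp) (by simp))
  rw [Set.pairwise_pair]
  exact fun _ => ⟨hxy, fun h => hxy (Setoid.symm' _ h)⟩

theorem IsCovering.mem_closure_pair_iff (hC : IsCovering C) {x y z : U}
    (hxy : ¬ simSetoid C x y) (hxz : ¬ simSetoid C x z) (hyz : ¬ simSetoid C y z) :
    z ∈ (transversalMatroid C).closure {x, y} ↔ (blocksMeeting C {x, y, z}).ncard ≤ 2 := by
  have h3 := ncard_triple (ne_of_not_simSetoid hxy) (ne_of_not_simSetoid hxz)
    (ne_of_not_simSetoid hyz)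
  have hset : insert z ({x, y} : Set U) = {x, y, z} := by
    ext; simp; tauto
  rw [(hC.pair_indep hxy).mem_closure_iff', hset, transversalMatroid_indep]
  have hz : z ∉ ({x, y} : Set U) := by
    simp [(ne_of_not_simSetoid hxz).symm, (ne_of_not_simSetoid hyz).symm]
  simp only [transversalMatroid_ground, Set.mem_univ, true_and, hz]
  constructor
  · intro h
    by_contra! hlt
    refine h (hC.isPartialTransversal ?_ h3.le (by omega))
    intro a ha b hb _
    have := fun a b (h : simSetoid C a b) => Setoid.symm' _ h
    simp only [Set.mem_insert_iff, Set.mem_singleton_iff] at ha hb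
    grind
  · intro h hT
    rw [isPartialTransversal_iff] at hT
    have := hT _ subset_rfl
    omega

/-- The classes of `∼` are the parallel classes of the matroid: an inequivalent pair is independent,
while a pair of distinct equivalent elements meets just one block. -/
theorem IsCovering.mem_closure_singleton_iff (hC : IsCovering C) {x y : U} :
    y ∈ (transversalMatroid C).closure {x} ↔ simSetoid C x y := by
  have hx : (transversalMatroid C).Indep {x} := by
    rw [transversalMatroid_indep]
    refine hC.isPartialTransversal (Set.pairwise_singleton _ _) (by simp) ?_
    rw [Set.ncard_singleton]
    exact (Set.ncard_pos (Set.toFinite _)).2 (hC.blocksMeeting_nonempty x)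
  rw [hx.mem_closure_iff']
  simp only [transversalMatroid_ground, Set.mem_univ, true_and, Set.mem_singleton_iff]
  constructor
  · intro h
    by_contra hxy
    exact (ne_of_not_simSetoid hxy).symm (h (Set.pair_comm x y ▸ hC.pair_indep hxy))
  · rintro (h | ⟨h, h1⟩) hT
    · exact h.symm
    · by_contra hne
      rw [transversalMatroid_indep, isPartialTransversal_iff] at hT
      have h2 := hT _ subset_rfl
      rw [Set.ncard_pair hne, ← Set.singleton_union, blocksMeeting_union, ← h, Set.union_self,
        h1] at h2
      omega

end Blocks

/-! ### Points and collinearity in the lattice of flats -/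

section Lattice

variable {U : Type*} [Finite U] {C : Set (Set U)} {P : Type*} [PartialOrder P]

/-- The image, under an isomorphism of the lattice of flats with `P`, of the flat spanned by a
single element. -/
def pointOf (φ : ClosedSets C ≃o P) (x : U) : P :=
  φ ⟨(transversalMatroid C).closure {x}, (transversalMatroid C).isFlat_closure {x}⟩

theorem pointOf_le_iff (φ : ClosedSets C ≃o P) {x : U} {q : P} :
    pointOf φ x ≤ q ↔ x ∈ (φ.symm q).1 := by
  have h := (φ.symm q).2
  rw [pointOf, ← OrderIso.le_symm_apply, ← Subtype.coe_le_coe]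
  constructor
  · intro h'
    exact h' (Matroid.mem_closure_of_mem' _ rfl (by simp))
  · intro h'
    calc _ ⊆ (transversalMatroid C).closure (φ.symm q).1 :=
          Matroid.closure_subset_closure _ (Set.singleton_subset_iff.2 h')
      _ = _ := h.closure

theorem pointOf_le_pointOf_iff (hC : IsCovering C) (φ : ClosedSets C ≃o P) {x y : U} :
    pointOf φ x ≤ pointOf φ y ↔ simSetoid C y x := by
  rw [pointOf_le_iff, pointOf, OrderIso.symm_apply_apply, hC.mem_closure_singleton_iff]

theorem pointOf_eq_iff (hC : IsCovering C) (φ : ClosedSets C ≃o P) {x y : U} :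
    pointOf φ x = pointOf φ y ↔ simSetoid C x y := by
  constructor
  · exact fun h => (pointOf_le_pointOf_iff hC φ).1 h.ge
  · exact fun h => le_antisymm ((pointOf_le_pointOf_iff hC φ).2 (Setoid.symm' _ h))
      ((pointOf_le_pointOf_iff hC φ).2 h)

theorem notMem_closure_empty (hC : IsCovering C) (x : U) :
    x ∉ (transversalMatroid C).closure ∅ := by
  have h := hC.isPartialTransversal (T := {x}) (Set.pairwise_singleton _ _) (by simp) (by
    rw [Set.ncard_singleton]
    exact (Set.ncard_pos (Set.toFinite _)).2 (hC.blocksMeeting_nonempty x))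
  rw [← transversalMatroid_indep] at h
  simpa using h.notMem_closure_sdiff_of_mem (Set.mem_singleton x)

/-- Otherwise the flat of `q` has no elements, and the empty flat lies below everything. -/
theorem exists_pointOf_le (φ : ClosedSets C ≃o P) {q : P} (hq : ∃ s, ¬ q ≤ s) :
    ∃ x : U, pointOf φ x ≤ q := by
  by_contra! h
  obtain ⟨s, hs⟩ := hq
  refine hs ?_
  rw [← φ.symm.le_iff_le, ← Subtype.coe_le_coe]
  exact fun x hx => absurd ((pointOf_le_iff φ).2 hx) (h x)

theorem isPoint_pointOf (hC : IsCovering C) (φ : ClosedSets C ≃o P) (x : U) :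
    IsPoint (pointOf φ x) := by
  refine ⟨⟨φ ⟨_, (transversalMatroid C).isFlat_closure ∅⟩, ?_⟩, fun r hr => ?_⟩
  · rw [pointOf_le_iff, OrderIso.symm_apply_apply]
    exact notMem_closure_empty hC x
  · by_contra! h
    obtain ⟨y, hy⟩ := exists_pointOf_le φ h.2
    have hyx := (pointOf_le_pointOf_iff hC φ).1 (hy.trans hr)
    exact h.1 (hr.antisymm ((pointOf_eq_iff hC φ).2 hyx ▸ hy))

theorem exists_pointOf_eq (φ : ClosedSets C ≃o P) (hC : IsCovering C) {q : P} (hq : IsPoint q) :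
    ∃ x : U, pointOf φ x = q := by
  obtain ⟨x, hx⟩ := exists_pointOf_le φ hq.1
  exact ⟨x, (isPoint_pointOf hC φ x).eq_of_le hq hx⟩

/-- Three distinct points are collinear exactly if their elements meet at most two blocks. -/
theorem collinear_iff (hC : IsCovering C) (φ : ClosedSets C ≃o P) {x y z : U}
    (hxy : pointOf φ x ≠ pointOf φ y) (hxz : pointOf φ x ≠ pointOf φ z)
    (hyz : pointOf φ y ≠ pointOf φ z) :
    (∀ q, pointOf φ x ≤ q → pointOf φ y ≤ q → pointOf φ z ≤ q) ↔
      (blocksMeeting C {x, y, z}).ncard ≤ 2 := by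
  rw [Ne, pointOf_eq_iff hC] at hxy hxz hyz
  rw [← hC.mem_closure_pair_iff hxy hxz hyz]
  simp only [pointOf_le_iff]
  constructor
  · intro h
    -- The flat spanned by `x` and `y` is their least common upper bound, so it is the one to test.
    have h' := h (φ ⟨_, (transversalMatroid C).isFlat_closure {x, y}⟩)
    rw [OrderIso.symm_apply_apply] at h'
    exact h' (Matroid.mem_closure_of_mem' _ (by simp) (by simp))
      (Matroid.mem_closure_of_mem' _ (by simp) (by simp))
  · intro h q hx hy
    rw [← (φ.symm q).2.closure]
    exact Matroid.closure_subset_closure _ (by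
      rw [Set.insert_subset_iff, Set.singleton_subset_iff]; exact ⟨hx, hy⟩) h

end Lattice

end CoveringLattice

/-! ### The Dowling order in terms of pairs of indices -/

namespace Dowling

namespace PartialGPartition

variable {n : ℕ} {G : Type*}

/-- `i` and `j` lie in the same nonzero block. -/
def SameBlock (x : PartialGPartition n G) (i j : Fin n) : Prop :=
  ∃ B ∈ x.parts.parts, i ∈ B ∧ j ∈ B

theorem sameBlock_self (x : PartialGPartition n G) {i : Fin n} (h : i ∉ x.zero) :
    x.SameBlock i i := by
  obtain ⟨B, hB, hi⟩ := x.parts.exists_mem (Finset.mem_compl.2 h)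
  exact ⟨B, hB, hi, hi⟩

theorem SameBlock.notMem_zero {x : PartialGPartition n G} {i j : Fin n} (h : x.SameBlock i j) :
    i ∉ x.zero ∧ j ∉ x.zero := by
  obtain ⟨B, hB, hi, hj⟩ := h
  exact ⟨Finset.mem_compl.1 (x.parts.le hB hi), Finset.mem_compl.1 (x.parts.le hB hj)⟩

theorem SameBlock.symm {x : PartialGPartition n G} {i j : Fin n} (h : x.SameBlock i j) :
    x.SameBlock j i := by
  obtain ⟨B, hB, hi, hj⟩ := h
  exact ⟨B, hB, hj, hi⟩

theorem SameBlock.trans {x : PartialGPartition n G} {i j k : Fin n} (h : x.SameBlock i j)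
    (h' : x.SameBlock j k) : x.SameBlock i k := by
  obtain ⟨B, hB, hi, hj⟩ := h
  obtain ⟨B', hB', hj', hk⟩ := h'
  obtain rfl := x.parts.eq_of_mem_parts hB hB' hj hj'
  exact ⟨B, hB, hi, hk⟩

open Classical in
/-- The partial `G`-partition with zero block `Z` whose nonzero blocks are the fibres of `f`
outside of `Z`. -/
noncomputable def ofFun (Z : Finset (Fin n)) (f : Fin n → Fin n) (l : Fin n → G) :
    PartialGPartition n G where
  zero := Z
  parts := Finpartition.ofSetSetoid (Setoid.ker f) Zᶜ
  label := l

theorem sameBlock_ofFun {Z : Finset (Fin n)} {f : Fin n → Fin n} {l : Fin n → G} {i j : Fin n} :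
    (ofFun Z f l).SameBlock i j ↔ i ∉ Z ∧ j ∉ Z ∧ f i = f j := by
  classical
  simp only [SameBlock, ofFun, Finpartition.ofSetSetoid_parts, Finset.mem_image,
    exists_exists_and_eq_and, Finset.mem_filter, Finset.mem_compl]
  constructor
  · rintro ⟨a, ha, ⟨hi, hai⟩, hj, haj⟩
    exact ⟨hi, hj, (show f a = f i from hai).symm.trans haj⟩
  · rintro ⟨hi, hj, h⟩
    exact ⟨i, hi, ⟨hi, rfl⟩, hj, h⟩

variable [Group G]

/-- The order of partial `G`-partitions in terms of pairs of elements. -/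
theorem le_iff {x y : PartialGPartition n G} : Le x y ↔ x.zero ⊆ y.zero ∧
    ∀ i j, x.SameBlock i j → i ∈ y.zero ∧ j ∈ y.zero ∨
      y.SameBlock i j ∧ (y.label i)⁻¹ * y.label j = (x.label i)⁻¹ * x.label j := by
  classical
  constructor
  · rintro ⟨h0, h⟩
    refine ⟨h0, ?_⟩
    -- The quotient `(label i)⁻¹ * label j` does not change when the labels of a block are
    -- multiplied on the left by a constant, so it can be compared directly.
    have key : ∀ i j, x.SameBlock i j → i ∉ y.zero →
        y.SameBlock i j ∧ (y.label i)⁻¹ * y.label j = (x.label i)⁻¹ * x.label j := by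
      rintro i j ⟨B, hB, hi, hj⟩ hi'
      obtain ⟨B', hB', hiB'⟩ := y.parts.exists_mem (Finset.mem_compl.2 hi')
      obtain ⟨⟨P, hP, hPB⟩, hlab⟩ := h B' hB'
      rw [← hPB] at hiB'
      obtain ⟨A, hA, hiA⟩ := Finset.mem_biUnion.1 hiB'
      obtain rfl := x.parts.eq_of_mem_parts hB (hP hA) hi hiA
      have hBB' : B ⊆ B' := hPB ▸ Finset.subset_biUnion_of_mem id hA
      obtain ⟨g, hg⟩ := hlab B hB hBB'
      refine ⟨⟨B', hB', hBB' hi, hBB' hj⟩, ?_⟩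
      rw [hg i hi, hg j hj]
      group
    intro i j hij
    by_cases hi : i ∈ y.zero
    · by_cases hj : j ∈ y.zero
      · exact Or.inl ⟨hi, hj⟩
      · exact absurd hi (key j i hij.symm hj).1.notMem_zero.2
    · exact Or.inr (key i j hij hi)
  · rintro ⟨h0, h⟩
    refine ⟨h0, fun B' hB' => ⟨⟨x.parts.parts.filter (· ⊆ B'), Finset.filter_subset _ _, ?_⟩, ?_⟩⟩
    · ext i
      simp only [Finset.mem_biUnion, Finset.mem_filter, id]
      constructor
      · rintro ⟨B, ⟨_, hB⟩, hi⟩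
        exact hB hi
      · intro hi
        have hiy := Finset.mem_compl.1 (y.parts.le hB' hi)
        obtain ⟨B, hB, hiB⟩ := x.parts.exists_mem (Finset.mem_compl.2 fun hix => hiy (h0 hix))
        refine ⟨B, ⟨hB, fun j hj => ?_⟩, hiB⟩
        obtain ⟨D, hD, hiD, hjD⟩ := ((h i j ⟨B, hB, hiB, hj⟩).resolve_left fun h => hiy h.1).1
        exact y.parts.eq_of_mem_parts hD hB' hiD hi ▸ hjD
    · intro B hB hBB'
      obtain ⟨i, hi⟩ := x.parts.nonempty_of_mem_parts hB
      -- This constant is forced by the index `i`; equality of quotients carries it over to all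
      -- other `j` in `B`.
      refine ⟨y.label i * (x.label i)⁻¹, fun j hj => ?_⟩
      have hiy := Finset.mem_compl.1 (y.parts.le hB' (hBB' hi))
      have := ((h i j ⟨B, hB, hi, hj⟩).resolve_left fun h => hiy h.1).2
      rw [mul_assoc, ← this, mul_inv_cancel_left]

/-- The partial `G`-partition with zero block `Z` and all other blocks singletons. -/
noncomputable def zeroBlock (Z : Finset (Fin n)) : PartialGPartition n G := ofFun Z id 1

/-- The partial `G`-partition with empty zero block whose only nontrivial block is `{i, j}`, on
which the labels differ by `g`. -/
noncomputable def pair (i j : Fin n) (g : G) : PartialGPartition n G :=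
  ofFun ∅ (fun k => if k = j then i else k) (fun k => if k = j then g else 1)

theorem zeroBlock_le_iff {Z : Finset (Fin n)} {y : PartialGPartition n G} :
    Le (zeroBlock Z) y ↔ Z ⊆ y.zero := by
  refine le_iff.trans ⟨fun h => h.1, fun h => ⟨h, fun i j hij => ?_⟩⟩
  obtain ⟨_, _, rfl⟩ : i ∉ Z ∧ j ∉ Z ∧ i = j := sameBlock_ofFun.1 hij
  by_cases hi : i ∈ y.zero
  · exact Or.inl ⟨hi, hi⟩
  · exact Or.inr ⟨y.sameBlock_self hi, by simp⟩

theorem sameBlock_pair {i j : Fin n} {g : G} {a b : Fin n} :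
    (pair i j g).SameBlock a b ↔ a = b ∨ (a = i ∧ b = j) ∨ (a = j ∧ b = i) := by
  refine sameBlock_ofFun.trans ?_
  grind

theorem pair_le_iff {i j : Fin n} (hij : i ≠ j) {g : G} {y : PartialGPartition n G} :
    Le (pair i j g) y ↔ (i ∈ y.zero ∧ j ∈ y.zero) ∨
      (y.SameBlock i j ∧ (y.label i)⁻¹ * y.label j = g) := by
  have hl : ∀ k, (pair i j g).label k = if k = j then g else 1 := fun k => rfl
  rw [le_iff]
  constructor
  · rintro ⟨_, h⟩
    have := h i j (sameBlock_pair.2 (by simp))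
    simpa [hl, hij] using this
  · refine fun h => ⟨Finset.empty_subset _, fun a b hab => ?_⟩
    rcases sameBlock_pair.1 hab with rfl | ⟨rfl, rfl⟩ | ⟨rfl, rfl⟩
    · by_cases ha : a ∈ y.zero
      · exact Or.inl ⟨ha, ha⟩
      · exact Or.inr ⟨y.sameBlock_self ha, by simp⟩
    · simpa [hl, hij] using h
    · rcases h with h | ⟨h, hg⟩
      · exact Or.inl h.symm
      · refine Or.inr ⟨h.symm, ?_⟩
        rw [hl, hl, if_pos rfl, if_neg hij, ← hg]
        group

/-- This identifies the bottom element, as needed for `IsPoint`. -/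
theorem le_of_trivial {x : PartialGPartition n G} (h0 : x.zero = ∅)
    (h : ∀ i j, x.SameBlock i j → i = j) (y : PartialGPartition n G) : Le x y := by
  refine le_iff.2 ⟨by simp [h0], fun i j hij => ?_⟩
  obtain rfl := h i j hij
  by_cases hi : i ∈ y.zero
  · exact Or.inl ⟨hi, hi⟩
  · exact Or.inr ⟨y.sameBlock_self hi, by simp⟩

end PartialGPartition

/-! ### Points of the Dowling lattice -/

namespace DowlingLattice

open PartialGPartition

variable {n : ℕ} {G : Type*} [Group G]

/-- The element of the Dowling lattice represented by a partial `G`-partition. -/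
def mk (x : PartialGPartition n G) : DowlingLattice n G := Quotient.mk _ x

theorem mk_surjective : Function.Surjective (mk : PartialGPartition n G → DowlingLattice n G) :=
  Quotient.mk_surjective

theorem mk_le_mk {x y : PartialGPartition n G} : mk x ≤ mk y ↔ Le x y := Iff.rfl

/-- The point of the Dowling lattice with zero block `{i}`. -/
noncomputable def zeroPoint (i : Fin n) : DowlingLattice n G := mk (zeroBlock {i})

/-- The point of the Dowling lattice with the block `{i, j}`, on which the labels differ by `g`. -/
noncomputable def pairPoint (i j : Fin n) (g : G) : DowlingLattice n G := mk (pair i j g)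

theorem zeroPoint_le_iff {i : Fin n} {y : PartialGPartition n G} :
    zeroPoint i ≤ mk y ↔ i ∈ y.zero := by
  rw [zeroPoint, mk_le_mk, zeroBlock_le_iff, Finset.singleton_subset_iff]

theorem pairPoint_le_iff {i j : Fin n} (hij : i ≠ j) {g : G} {y : PartialGPartition n G} :
    pairPoint i j g ≤ mk y ↔ (i ∈ y.zero ∧ j ∈ y.zero) ∨
      (y.SameBlock i j ∧ (y.label i)⁻¹ * y.label j = g) :=
  pair_le_iff hij

theorem zeroPoint_injective :
    Function.Injective (zeroPoint : Fin n → DowlingLattice n G) := by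
  intro i j h
  simpa [zeroBlock, ofFun] using zeroPoint_le_iff.1 (show zeroPoint i ≤ mk (zeroBlock {j}) from h.le)

theorem zeroPoint_ne_pairPoint (i j k : Fin n) (g : G) : zeroPoint i ≠ pairPoint j k g := by
  intro h
  simpa [pair, ofFun] using zeroPoint_le_iff.1 (show zeroPoint i ≤ mk (pair j k g) from h.le)

theorem pairPoint_eq {i j k l : Fin n} {g h : G} (hij : i ≠ j)
    (he : pairPoint i j g = pairPoint k l h) : (i = k ∧ j = l) ∨ (i = l ∧ j = k) := by
  have := (pairPoint_le_iff hij).1 (show pairPoint i j g ≤ mk (pair k l h) from he.le)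
  rw [sameBlock_pair] at this
  simpa [hij, pair, ofFun] using this.imp id And.left

theorem pairPoint_injective {i j : Fin n} (hij : i ≠ j) :
    Function.Injective (pairPoint i j : G → DowlingLattice n G) := by
  intro g h he
  have := (pairPoint_le_iff hij).1 (show pairPoint i j g ≤ mk (pair i j h) from he.le)
  simpa [hij, pair, ofFun, eq_comm] using this.imp id And.right

theorem isPoint_zeroPoint (i : Fin n) : IsPoint (zeroPoint i : DowlingLattice n G) := by
  refine ⟨⟨mk (zeroBlock ∅), by simp [zeroPoint_le_iff, zeroBlock, ofFun]⟩, fun r hr => ?_⟩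
  obtain ⟨x, rfl⟩ := mk_surjective r
  obtain ⟨h0, h⟩ := le_iff.1 (mk_le_mk.1 hr)
  rcases Finset.subset_singleton_iff.1 h0 with h0 | h0
  · right
    intro s
    obtain ⟨y, rfl⟩ := mk_surjective s
    refine le_of_trivial h0 (fun a b hab => ?_) y
    rcases h a b hab with ⟨ha, hb⟩ | h
    · exact (Finset.mem_singleton.1 ha).trans (Finset.mem_singleton.1 hb).symm
    · exact (sameBlock_ofFun.1 h.1).2.2
  · left
    exact le_antisymm hr (zeroPoint_le_iff.2 (h0 ▸ Finset.mem_singleton_self i))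

theorem isPoint_pairPoint {i j : Fin n} (hij : i ≠ j) (g : G) : IsPoint (pairPoint i j g) := by
  refine ⟨⟨mk (zeroBlock ∅), ?_⟩, fun r hr => ?_⟩
  · rw [pairPoint_le_iff hij, zeroBlock, sameBlock_ofFun]
    simp [ofFun, hij]
  obtain ⟨x, rfl⟩ := mk_surjective r
  obtain ⟨h0, h⟩ := le_iff.1 (mk_le_mk.1 hr)
  replace h0 : x.zero = ∅ := Finset.subset_empty.1 h0
  replace h : ∀ a b, x.SameBlock a b → _ := fun a b hab =>
    (h a b hab).resolve_left fun h => Finset.notMem_empty _ h.1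
  by_cases hx : x.SameBlock i j
  · left
    refine le_antisymm hr ((pairPoint_le_iff hij).2 (Or.inr ⟨hx, (h i j hx).2.symm.trans ?_⟩))
    simp [pair, ofFun, hij]
  · right
    intro s
    obtain ⟨y, rfl⟩ := mk_surjective s
    refine le_of_trivial h0 (fun a b hab => ?_) y
    rcases sameBlock_pair.1 (h a b hab).1 with h | ⟨rfl, rfl⟩ | ⟨rfl, rfl⟩
    · exact h
    · exact absurd hab hx
    · exact absurd hab.symm hx

/-- A nonempty zero block puts a zero point below `p`, and two indices in one nonzero block put a
pair point below it; either must then equal `p`. If neither occurs, `p` is the bottom. Requiring `i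
< j` loses nothing, since swapping the indices only inverts `g`. -/
theorem eq_zeroPoint_or_pairPoint {p : DowlingLattice n G} (hp : IsPoint p) :
    (∃ i, p = zeroPoint i) ∨ ∃ i j, i < j ∧ ∃ g, p = pairPoint i j g := by
  obtain ⟨x, rfl⟩ := mk_surjective p
  by_cases h0 : x.zero = ∅
  · right
    by_contra! hne
    have key : ∀ i j, i < j → ¬ x.SameBlock i j := fun i j hij hx =>
      hne i j hij _ ((isPoint_pairPoint hij.ne _).eq_of_le hp
        ((pairPoint_le_iff hij.ne).2 (Or.inr ⟨hx, rfl⟩))).symm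
    obtain ⟨⟨r, hr⟩, -⟩ := hp
    obtain ⟨y, rfl⟩ := mk_surjective r
    refine hr (le_of_trivial h0 (fun i j hij => ?_) y)
    rcases lt_trichotomy i j with h | h | h
    · exact absurd hij (key i j h)
    · exact h
    · exact absurd hij.symm (key j i h)
  · left
    obtain ⟨i, hi⟩ := Finset.nonempty_iff_ne_empty.2 h0
    exact ⟨i, ((isPoint_zeroPoint i).eq_of_le hp (zeroPoint_le_iff.2 hi)).symm⟩

/-- The points of the Dowling lattice of rank two. -/
noncomputable def pointsRankTwo (G : Type*) [Group G] :
    Fin 2 ⊕ G → {p : DowlingLattice 2 G // IsPoint p} :=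
  Sum.elim (fun i => ⟨zeroPoint i, isPoint_zeroPoint i⟩)
    (fun g => ⟨pairPoint 0 1 g, isPoint_pairPoint (by simp) g⟩)

theorem pointsRankTwo_bijective : Function.Bijective (pointsRankTwo G) := by
  constructor
  · rintro (i | g) (j | h) he <;> replace he := congrArg Subtype.val he
    · exact congrArg _ (zeroPoint_injective he)
    · exact absurd he (zeroPoint_ne_pairPoint _ _ _ _)
    · exact absurd he.symm (zeroPoint_ne_pairPoint _ _ _ _)
    · exact congrArg _ (pairPoint_injective (by simp) he)
  · rintro ⟨p, hp⟩
    rcases eq_zeroPoint_or_pairPoint hp with ⟨i, rfl⟩ | ⟨i, j, hij, g, rfl⟩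
    · exact ⟨Sum.inl i, rfl⟩
    · obtain ⟨rfl, rfl⟩ : i = 0 ∧ j = 1 := by omega
      exact ⟨Sum.inr g, rfl⟩

/-- An upper bound of a point that is not the top has either exactly one index in its zero block,
which admits only that zero point, or the block `{0, 1}` with a fixed label quotient, which admits
only one pair point. -/
theorem le_of_two_points {p q : DowlingLattice 2 G} (hp : IsPoint p) (hq : IsPoint q)
    (hpq : p ≠ q) {r : DowlingLattice 2 G} (hpr : p ≤ r) (hqr : q ≤ r) (s : DowlingLattice 2 G) :
    s ≤ r := by
  obtain ⟨y, rfl⟩ := mk_surjective r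
  obtain ⟨x, rfl⟩ := mk_surjective s
  suffices h : 0 ∈ y.zero ∧ 1 ∈ y.zero by
    have hall : ∀ i, i ∈ y.zero := Fin.forall_fin_two.2 h
    exact le_iff.2 ⟨fun i _ => hall i, fun i j _ => Or.inl ⟨hall i, hall j⟩⟩
  obtain ⟨a, ha⟩ := pointsRankTwo_bijective.2 ⟨p, hp⟩
  obtain ⟨b, hb⟩ := pointsRankTwo_bijective.2 ⟨q, hq⟩
  obtain rfl : _ = p := congrArg Subtype.val ha
  obtain rfl : _ = q := congrArg Subtype.val hb
  have h01 := fun g : G => (pairPoint_le_iff (y := y) (g := g) (zero_ne_one (α := Fin 2))).1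
  have hnot : y.SameBlock 0 1 → ∀ i, i ∉ y.zero := fun h => Fin.forall_fin_two.2 h.notMem_zero
  rcases a with i | g <;> rcases b with j | h
  · have hi := zeroPoint_le_iff.1 hpr
    have hj := zeroPoint_le_iff.1 hqr
    have hij : i ≠ j := fun h => hpq (h ▸ rfl)
    fin_cases i <;> fin_cases j <;> simp_all
  · have hi := zeroPoint_le_iff.1 hpr
    rcases h01 h hqr with h | ⟨h, -⟩
    · exact h
    · exact absurd hi (hnot h i)
  · have hi := zeroPoint_le_iff.1 hqr
    rcases h01 g hpr with h | ⟨h, -⟩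
    · exact h
    · exact absurd hi (hnot h j)
  · rcases h01 g hpr with h1 | ⟨h1, h1'⟩
    · exact h1
    · rcases h01 h hqr with h2 | ⟨h2, h2'⟩
      · exact h2
      · exact absurd (by rw [← h1', ← h2']) hpq

end DowlingLattice

end Dowling

/-! ### Block counts against the lines of the Dowling lattice -/

namespace CoveringLattice

open Dowling Dowling.DowlingLattice Dowling.PartialGPartition

variable {U : Type*} [Finite U] {C : Set (Set U)} {G : Type*} [Group G]

/-- The elements of three distinct collinear points meet exactly two blocks in total, and so do
any two of them. -/
theorem blocksMeeting_eq_of_collinear {P : Type*} [PartialOrder P] (hC : IsCovering C)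
    (φ : ClosedSets C ≃o P) {x y z : U} (hxy : pointOf φ x ≠ pointOf φ y)
    (hxz : pointOf φ x ≠ pointOf φ z) (hyz : pointOf φ y ≠ pointOf φ z)
    (h : ∀ q, pointOf φ x ≤ q → pointOf φ y ≤ q → pointOf φ z ≤ q) :
    (blocksMeeting C {x, y, z}).ncard = 2 ∧
      blocksMeeting C {x, y} = blocksMeeting C {x, y, z} := by
  have h1 := (collinear_iff hC φ hxy hxz hyz).1 h
  rw [Ne, pointOf_eq_iff hC] at hxy
  have h2 := hC.two_le_ncard_blocksMeeting hxy (H := {x, y}) (by simp) (by simp)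
  have h3 : blocksMeeting C {x, y} ⊆ blocksMeeting C {x, y, z} :=
    blocksMeeting_mono C (by intro; simp; tauto)
  have h4 := Set.ncard_le_ncard h3 (Set.toFinite _)
  exact ⟨by omega, Set.eq_of_subset_of_ncard_le h3 (by omega) (Set.toFinite _)⟩

/-- An element on two distinct lines lies in exactly one block. -/
theorem ncard_blocksMeeting_eq_one (hC : IsCovering C) {x : U} {A B : Set (Set U)}
    (hA : A.ncard = 2) (hB : B.ncard = 2) (hAB : A ≠ B) (hxA : blocksMeeting C {x} ⊆ A)
    (hxB : blocksMeeting C {x} ⊆ B) : (blocksMeeting C {x}).ncard = 1 := by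
  have h0 := (Set.ncard_pos (Set.toFinite _)).2 (hC.blocksMeeting_nonempty x)
  have h1 := Set.ncard_le_ncard hxA (Set.toFinite _)
  -- An element with two blocks would determine both pairs, as each equals its set of blocks.
  by_contra hne
  exact hAB ((Set.eq_of_subset_of_ncard_le hxA (by omega) (Set.toFinite _)).symm.trans
    (Set.eq_of_subset_of_ncard_le hxB (by omega) (Set.toFinite _)))

/-- A line of three distinct points contains one whose element lies in two blocks. -/
theorem not_forall_ncard_eq_one {x y z : U} (hxy : ¬ simSetoid C x y)
    (hxz : ¬ simSetoid C x z) (hyz : ¬ simSetoid C y z)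
    (hA : (blocksMeeting C {x, y, z}).ncard ≤ 2) :
    ¬ ((blocksMeeting C {x}).ncard = 1 ∧ (blocksMeeting C {y}).ncard = 1 ∧
      (blocksMeeting C {z}).ncard = 1) := by
  rintro ⟨hx, hy, hz⟩
  have h : ∀ w ∈ ({x, y, z} : Set U), blocksMeeting C {w} ⊆ blocksMeeting C {x, y, z} :=
    fun w hw => blocksMeeting_mono C (Set.singleton_subset_iff.2 hw)
  have hx' := h x (by simp)
  have hy' := h y (by simp)
  have hz' := h z (by simp)
  -- Inequivalent elements with one block each have different blocks, so three of them need three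
  -- blocks.
  have nxy : blocksMeeting C {x} ≠ blocksMeeting C {y} := fun h => hxy (Or.inr ⟨h, hx⟩)
  have nxz : blocksMeeting C {x} ≠ blocksMeeting C {z} := fun h => hxz (Or.inr ⟨h, hx⟩)
  have nyz : blocksMeeting C {y} ≠ blocksMeeting C {z} := fun h => hyz (Or.inr ⟨h, hy⟩)
  obtain ⟨a, ha⟩ := Set.ncard_eq_one.1 hx
  obtain ⟨b, hb⟩ := Set.ncard_eq_one.1 hy
  obtain ⟨c, hc⟩ := Set.ncard_eq_one.1 hz
  rw [ha, Set.singleton_subset_iff] at hx'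
  rw [hb, Set.singleton_subset_iff] at hy'
  rw [hc, Set.singleton_subset_iff] at hz'
  rw [ha, hb, Ne, Set.singleton_eq_singleton_iff] at nxy
  rw [ha, hc, Ne, Set.singleton_eq_singleton_iff] at nxz
  rw [hb, hc, Ne, Set.singleton_eq_singleton_iff] at nyz
  have h3 := Set.ncard_le_ncard (s := {a, b, c}) (t := blocksMeeting C {x, y, z})
    (by rintro _ (rfl | rfl | rfl) <;> assumption) (Set.toFinite _)
  rw [ncard_triple nxy nxz nyz] at h3
  omega

/-- Each of the points `x`, `y`, `u` on the line of `i` and `j` lies on a second line of the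
quadrilateral: `x z v`, `y z w` and `u w v`. So all three lie in single blocks, which is impossible.
-/
theorem lt_three_of_orderIso (hC : IsCovering C) {n : ℕ}
    (φ : ClosedSets C ≃o DowlingLattice n G) : n < 3 := by
  by_contra! hn
  obtain ⟨i, j, k, hij, hik, hjk⟩ : ∃ i j k : Fin n, i ≠ j ∧ i ≠ k ∧ j ≠ k :=
    ⟨⟨0, by omega⟩, ⟨1, by omega⟩, ⟨2, by omega⟩, by simp, by simp, by simp⟩
  obtain ⟨x, hx⟩ := exists_pointOf_eq φ hC (isPoint_zeroPoint i)
  obtain ⟨y, hy⟩ := exists_pointOf_eq φ hC (isPoint_zeroPoint j)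
  obtain ⟨z, hz⟩ := exists_pointOf_eq φ hC (isPoint_zeroPoint k)
  obtain ⟨u, hu⟩ := exists_pointOf_eq φ hC (isPoint_pairPoint hij (1 : G))
  obtain ⟨v, hv⟩ := exists_pointOf_eq φ hC (isPoint_pairPoint hik (1 : G))
  obtain ⟨w, hw⟩ := exists_pointOf_eq φ hC (isPoint_pairPoint hjk (1 : G))
  have nxy : pointOf φ x ≠ pointOf φ y := by
    rw [hx, hy]; exact zeroPoint_injective.ne hij
  have nxz : pointOf φ x ≠ pointOf φ z := by
    rw [hx, hz]; exact zeroPoint_injective.ne hik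
  have nyz : pointOf φ y ≠ pointOf φ z := by
    rw [hy, hz]; exact zeroPoint_injective.ne hjk
  have nxu : pointOf φ x ≠ pointOf φ u := by rw [hx, hu]; exact zeroPoint_ne_pairPoint _ _ _ _
  have nxv : pointOf φ x ≠ pointOf φ v := by rw [hx, hv]; exact zeroPoint_ne_pairPoint _ _ _ _
  have nyu : pointOf φ y ≠ pointOf φ u := by rw [hy, hu]; exact zeroPoint_ne_pairPoint _ _ _ _
  have nyv : pointOf φ y ≠ pointOf φ v := by rw [hy, hv]; exact zeroPoint_ne_pairPoint _ _ _ _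
  have nyw : pointOf φ y ≠ pointOf φ w := by rw [hy, hw]; exact zeroPoint_ne_pairPoint _ _ _ _
  have nzv : pointOf φ z ≠ pointOf φ v := by rw [hz, hv]; exact zeroPoint_ne_pairPoint _ _ _ _
  have nzw : pointOf φ z ≠ pointOf φ w := by rw [hz, hw]; exact zeroPoint_ne_pairPoint _ _ _ _
  have nuv : pointOf φ u ≠ pointOf φ v := by
    rw [hu, hv]; intro h; have := pairPoint_eq hij h; grind
  have nuw : pointOf φ u ≠ pointOf φ w := by
    rw [hu, hw]; intro h; have := pairPoint_eq hij h; grind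
  have nwv : pointOf φ w ≠ pointOf φ v := by
    rw [hw, hv]; intro h; have := pairPoint_eq hjk h; grind
  -- the lines through two of the points with a zero block
  have line : ∀ {a b : Fin n} (_ : a ≠ b) (q : DowlingLattice n G), zeroPoint a ≤ q →
      zeroPoint b ≤ q → pairPoint a b 1 ≤ q := by
    intro a b hab q h h'
    obtain ⟨q, rfl⟩ := mk_surjective q
    exact (pairPoint_le_iff hab).2 (Or.inl ⟨zeroPoint_le_iff.1 h, zeroPoint_le_iff.1 h'⟩)
  obtain ⟨hA, hA'⟩ := blocksMeeting_eq_of_collinear hC φ nxy nxu nyu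
    (by rw [hx, hy, hu]; exact line hij)
  obtain ⟨hB, -⟩ := blocksMeeting_eq_of_collinear hC φ nxz nxv nzv
    (by rw [hx, hz, hv]; exact line hik)
  obtain ⟨hD, -⟩ := blocksMeeting_eq_of_collinear hC φ nyz nyw nzw
    (by rw [hy, hz, hw]; exact line hjk)
  -- The fourth line: label quotients multiply along `i`, `j`, `k`, and `1 * 1 = 1`.
  obtain ⟨hE, -⟩ := blocksMeeting_eq_of_collinear hC φ nuw nuv nwv (by
    rw [hu, hw, hv]
    intro q h h'
    obtain ⟨q, rfl⟩ := mk_surjective q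
    rw [pairPoint_le_iff hij] at h
    rw [pairPoint_le_iff hjk] at h'
    rw [pairPoint_le_iff hik]
    rcases h with h | h <;> rcases h' with h' | h'
    · exact Or.inl ⟨h.1, h'.2⟩
    · exact absurd h.2 h'.1.notMem_zero.1
    · exact absurd h'.1 h.1.notMem_zero.2
    · refine Or.inr ⟨h.1.trans h'.1, ?_⟩
      rw [inv_mul_eq_one] at h h' ⊢
      exact h.2.trans h'.2)
  -- a line different from the first one, because it contains a point outside of it
  have off : ∀ {t : U} {L : Set (Set U)}, pointOf φ x ≠ pointOf φ t → pointOf φ y ≠ pointOf φ t →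
      ¬ pointOf φ t ≤ mk (zeroBlock {i, j}) → blocksMeeting C {t} ⊆ L →
      blocksMeeting C {x, y, u} ≠ L := by
    rintro t _ nxt nyt ht htL rfl
    -- If the blocks of `t` were among the two of the first line, `t` would be collinear with `x`
    -- and `y`, hence below their common upper bound with zero block `{i, j}`.
    refine ht ((collinear_iff hC φ nxy nxt nyt).2 ?_ _ ?_ ?_)
    · rw [← hA]
      refine Set.ncard_le_ncard ?_ (Set.toFinite _)
      have : ({x, y, t} : Set U) = {x, y} ∪ {t} := by ext; simp; tauto
      rw [this, blocksMeeting_union]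
      exact Set.union_subset hA'.subset htL
    · rw [hx, zeroPoint_le_iff]; simp [zeroBlock, ofFun]
    · rw [hy, zeroPoint_le_iff]; simp [zeroBlock, ofFun]
  have hzoff : ¬ pointOf φ z ≤ mk (zeroBlock {i, j}) := by
    rw [hz, zeroPoint_le_iff]; simp [zeroBlock, ofFun, hik.symm, hjk.symm]
  have hvoff : ¬ pointOf φ v ≤ mk (zeroBlock {i, j}) := by
    rw [hv, pairPoint_le_iff hik, zeroBlock, sameBlock_ofFun]
    simp [ofFun, hik.symm, hjk.symm]
  have sub : ∀ {t : U} {S : Set U}, t ∈ S → blocksMeeting C {t} ⊆ blocksMeeting C S :=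
    fun h => blocksMeeting_mono C (Set.singleton_subset_iff.2 h)
  refine not_forall_ncard_eq_one (by rwa [← pointOf_eq_iff hC φ])
    (by rwa [← pointOf_eq_iff hC φ]) (by rwa [← pointOf_eq_iff hC φ]) hA.le
    ⟨ncard_blocksMeeting_eq_one hC hA hB (off nxz nyz hzoff (sub ?_)) (sub ?_) (sub ?_),
      ncard_blocksMeeting_eq_one hC hA hD (off nxz nyz hzoff (sub ?_)) (sub ?_) (sub ?_),
      ncard_blocksMeeting_eq_one hC hA hE (off nxv nyv hvoff (sub ?_)) (sub ?_) (sub ?_)⟩ <;>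
    simp

/-- The parallel classes of a covering correspond to the points of its lattice of flats. -/
theorem card_quotient_eq {P : Type*} [PartialOrder P] (hC : IsCovering C)
    (φ : ClosedSets C ≃o P) :
    Nat.card (Quotient (simSetoid C)) = Nat.card {p : P // IsPoint p} := by
  refine Nat.card_eq_of_bijective
    (Quotient.lift (fun x => (⟨pointOf φ x, isPoint_pointOf hC φ x⟩ : {p : P // IsPoint p}))
      fun x y h => Subtype.ext ((pointOf_eq_iff hC φ).2 h)) ⟨?_, ?_⟩
  · rintro ⟨x⟩ ⟨y⟩ h
    exact Quotient.sound ((pointOf_eq_iff hC φ).1 (congrArg Subtype.val h))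
  · rintro ⟨p, hp⟩
    obtain ⟨x, hx⟩ := exists_pointOf_eq φ hC hp
    exact ⟨Quotient.mk _ x, Subtype.ext hx⟩

/-- A covering whose lattice of flats is the Dowling lattice of rank two has exactly two nonempty
blocks, and some element lies in both. -/
theorem blocksMeeting_of_rankTwo (hC : IsCovering C) (φ : ClosedSets C ≃o DowlingLattice 2 G) :
    (blocksMeeting C Set.univ).ncard = 2 ∧ ∃ x, (blocksMeeting C {x}).ncard = 2 := by
  have h01 : (0 : Fin 2) ≠ 1 := by simp
  obtain ⟨x, hx⟩ := exists_pointOf_eq φ hC (isPoint_zeroPoint 0)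
  obtain ⟨y, hy⟩ := exists_pointOf_eq φ hC (isPoint_zeroPoint 1)
  obtain ⟨z, hz⟩ := exists_pointOf_eq φ hC (isPoint_pairPoint h01 (1 : G))
  have nxy : pointOf φ x ≠ pointOf φ y := by rw [hx, hy]; exact zeroPoint_injective.ne h01
  have nxz : pointOf φ x ≠ pointOf φ z := by rw [hx, hz]; exact zeroPoint_ne_pairPoint _ _ _ _
  have nyz : pointOf φ y ≠ pointOf φ z := by rw [hy, hz]; exact zeroPoint_ne_pairPoint _ _ _ _
  have hline : ∀ {t}, pointOf φ x ≠ pointOf φ t → pointOf φ y ≠ pointOf φ t →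
      (blocksMeeting C {x, y, t}).ncard = 2 ∧
        blocksMeeting C {x, y} = blocksMeeting C {x, y, t} := fun nxt nyt =>
    blocksMeeting_eq_of_collinear hC φ nxy nxt nyt fun q h h' =>
      le_of_two_points (isPoint_pointOf hC φ x) (isPoint_pointOf hC φ y) nxy h h' _
  -- Each `t` is equivalent to `x` or `y`, or forms a third point on the line through them.
  have hsub : ∀ t, blocksMeeting C {t} ⊆ blocksMeeting C {x, y} := by
    intro t
    have key : ∀ s ∈ ({x, y} : Set U), pointOf φ s = pointOf φ t →
        blocksMeeting C {t} ⊆ blocksMeeting C {x, y} := by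
      intro s hs h
      have hst : blocksMeeting C {s} = blocksMeeting C {t} := by
        rcases (pointOf_eq_iff hC φ).1 h with rfl | h
        · rfl
        · exact h.1
      exact hst ▸ blocksMeeting_mono C (Set.singleton_subset_iff.2 hs)
    by_cases hxt : pointOf φ x = pointOf φ t
    · exact key x (by simp) hxt
    by_cases hyt : pointOf φ y = pointOf φ t
    · exact key y (by simp) hyt
    rw [(hline hxt hyt).2]
    exact blocksMeeting_mono C (by simp)
  obtain ⟨h2, h2'⟩ := hline nxz nyz
  have huniv : blocksMeeting C Set.univ = blocksMeeting C {x, y} := by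
    refine Set.Subset.antisymm ?_ (blocksMeeting_mono C (Set.subset_univ _))
    rintro K ⟨hK, t, htK, -⟩
    exact hsub t ⟨hK, t, htK, rfl⟩
  refine ⟨by rw [huniv, h2', h2], ?_⟩
  by_contra! hne
  have hone : ∀ t, (blocksMeeting C {t}).ncard = 1 := by
    intro t
    have h1 := (Set.ncard_pos (Set.toFinite _)).2 (hC.blocksMeeting_nonempty t)
    have h3 := Set.ncard_le_ncard (hsub t) (Set.toFinite _)
    have h4 := hne t
    rw [h2', h2] at h3
    omega
  exact not_forall_ncard_eq_one (by rwa [← pointOf_eq_iff hC φ])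
    (by rwa [← pointOf_eq_iff hC φ]) (by rwa [← pointOf_eq_iff hC φ]) h2.le
    ⟨hone x, hone y, hone z⟩

/-- An element in two blocks lies in every nonempty block, so its `lineOf` is everything. -/
theorem lines_eq_of_rankTwo (hC : IsCovering C) (φ : ClosedSets C ≃o DowlingLattice 2 G) :
    lines C = {Set.univ} := by
  obtain ⟨h2, x, hx⟩ := blocksMeeting_of_rankTwo hC φ
  have key : ∀ x, (blocksMeeting C {x}).ncard = 2 → lineOf C x = Set.univ := by
    intro x hx
    have h := Set.eq_of_subset_of_ncard_le (blocksMeeting_mono C (Set.subset_univ {x}))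
      (by omega) (Set.toFinite _)
    refine Set.eq_univ_of_forall fun y => ?_
    change blocksMeeting C {y} ⊆ blocksMeeting C {x}
    rw [h]
    exact blocksMeeting_mono C (Set.subset_univ {y})
  ext E
  constructor
  · rintro ⟨y, hy, rfl⟩
    exact key y hy
  · rintro rfl
    exact ⟨x, hx, (key x hx).symm⟩

end CoveringLattice

/-- `m` is the number of classes of `∼`, which is `|U|` for a reduced covering, and `k` is the
number of the sets `E(x)`, for which `|U| = k * |E(x)|`. -/
theorem mainTheorem5 {U : Type*} [Finite U] (C : Set (Set U))
    (hC : CoveringLattice.IsCovering C) {G : Type*} [Group G] [Finite G] (n : ℕ)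
    (hiso : Nonempty (CoveringLattice.ClosedSets C ≃o Dowling.DowlingLattice n G)) :
    (n = 0 ∨ n = 1 ∨ n = 2) ∧
    (n = 2 →
      Nat.card (Quotient (CoveringLattice.simSetoid C)) = Nat.card G + 2 ∧
      (CoveringLattice.IsReduced C → Nat.card U = Nat.card G + 2) ∧
      (CoveringLattice.lines C).ncard = 1 ∧
      ∀ E ∈ CoveringLattice.lines C,
        Nat.card U = (CoveringLattice.lines C).ncard * E.ncard) := by
  obtain ⟨φ⟩ := hiso
  refine ⟨by have := CoveringLattice.lt_three_of_orderIso hC φ; omega, ?_⟩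
  rintro rfl
  have hm : Nat.card (Quotient (CoveringLattice.simSetoid C)) = Nat.card G + 2 := by
    rw [CoveringLattice.card_quotient_eq hC φ,
      ← Nat.card_eq_of_bijective _ (Dowling.DowlingLattice.pointsRankTwo_bijective (G := G)),
      Nat.card_sum, Nat.card_fin, add_comm]
  have hl := CoveringLattice.lines_eq_of_rankTwo hC φ
  refine ⟨hm, fun hred => ?_, by rw [hl, Set.ncard_singleton], ?_⟩
  · rw [← hm]
    exact Nat.card_eq_of_bijective (Quotient.mk _)
      ⟨fun x y h => hred x y (Quotient.exact h), Quotient.mk_surjective⟩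
  · rw [hl]
    rintro _ rfl
    rw [Set.ncard_singleton, one_mul, Set.ncard_univ]
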